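/- Let $\omega=e^{2\pi i/3}$. A qutrit $Z$-spider with phases $(\alpha,\beta)$ (angles modulo $2\pi$), $m$ outputs and $n$ inputs is interpreted as the linear map $|0\rangle^{\otimes m}\langle 0|^{\otimes n}+e^{i\alpha}|1\rangle^{\otimes m}\langle 1|^{\otimes n}+e^{i\beta}|2\rangle^{\otimes m}\langle 2|^{\otimes n}$; an integer decoration $n$ (modulo 3) stands for the angle $2\pi n/3$. An $H$-edge carries the Hadamard gate $H=\frac1{\sqrt3}\sum_{j,k}\omega^{jk}|j\rangle\langle k|$ and an $H^\dagger$-edge carries $H^\dagger$. A graph-like qutrit ZX-diagram $D$ consists of finitely many $Z$-spiders with arbitrary phases, each pair of distinct spiders $u,v$ being joined by at most one edge, described by a weight $w_{u,v}=w_{v,u}\in\mathbb Z_3$ ($0$: no edge, $1$: $H$-edge, $2$: $H^\dagger$-edge; $w_{v,v}=0$), such that every input and output wire is attached to a spider and every spider is attached to at most one input or output wire. A spider is interior if it is attached to no input or output wire. The interpretation $\llbracket D\rrbracket$ is the linear map obtained by contracting the tensors of all spiders and edges. For $a\in\mathbb Z_3$, the $a$-local complementation $*_a x$ at a node $x$ replaces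 the weights by $w'_{u,v}=w_{u,v}+a\,w_{u,x}w_{v,x}$ $(u\neq v)$. For an edge $ij$ of non-zero weight and $a\in\{1,2\}$, the proper $a$-pivot along $ij$ is $((G*_a i)*_{-a}j)*_a i$. **Theorem.** Let $G$ be a finite weighted graph as above, with nodes $i,j$ joined by an edge of weight $w=w_{i,j}\in\{1,2\}$, and let $m_i,m_j\in\mathbb Z_3$. There is a scalar $c\in\mathbb C\setminus\{0\}$, depending only on these data, such that the following holds for every graph-like diagram $D$ (with any inputs, outputs and phases) with underlying graph $G$, in which $i$ and $j$ are interior $\mathcal M$-spiders with phases $(m_i,-m_i)$ and $(m_j,-m_j)$, i.e. phases in $\{(0,0),(1,2),(2,1)\}$. Let $a\in\{1,2\}$, and let $D'$ be the graph-like diagram obtained from $D$ by a proper $a$-pivot along $ij$, deletion of $i$ and $j$ together with all edges at them, and addition to the phases of every remaining spider $k$ of $$(\ell_k+q_k,\;-\ell_k+q_k),\qquad \ell_k=-w\,(m_i w_{k,j}+m_j w_{k,i}),\qquad q_k=-w\,w_{k,i}w_{k,j},$$ computed modulo 3 with the weights of $G$ (so only neighbours of $i$ or $j$ are affected, $q_k=-w$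 if $k$ is joined to $i$ and $j$ by edges of equal weight, $q_k=w$ if by edges of different non-zero weights, and $q_k=0$ otherwise). Then $$\llbracket D\rrbracket=c\,\llbracket D'\rrbracket ,$$ and the two choices of $a$ give the same diagram $D'$. -/

import Mathlib

open scoped Matrix

noncomputable section

namespace QutritZX

/-- The labels `0, 1, 2` of the `Z`-basis vectors of `ℂ³`. -/
abbrev Qutrit : Type := ZMod 3

/-- The primitive third root of unity `ω = exp(2πi/3)`. -/
def omega : ℂ := Complex.exp (2 * Real.pi * Complex.I / 3)

/-- The pair `(α, β)` of phases of a spider; phases are angles modulo `2π`. -/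
abbrev Phase : Type := Real.Angle × Real.Angle

/-- Integer decorations of spiders: `n`, taken modulo `3`, stands for the angle `2πn/3`. -/
def thirdTurn (n : ZMod 3) : Real.Angle := ((2 * Real.pi / 3 * (n.val : ℝ) : ℝ) : Real.Angle)

/-- The phase pair with integer decorations `a` and `b`. -/
def intPhase (a b : ZMod 3) : Phase := (thirdTurn a, thirdTurn b)

/-- The phase pairs of the family `M`. As `-1 = 2` and `-2 = 1` in `ZMod 3`, the values for
`m = 0, 1, 2` are `(0, 0)`, `(1, 2)` and `(2, 1)`. -/
def mPhase (m : ZMod 3) : Phase := intPhase m (-m)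

/-- The three coefficients `1, exp(iα), exp(iβ)` of a spider with phases `(α, β)`. -/
def phaseCoeff (φ : Phase) (b : Qutrit) : ℂ :=
  if b = 0 then 1 else if b = 1 then (φ.1.toCircle : ℂ) else (φ.2.toCircle : ℂ)

/-- The components of the vector `|b⟩ ⊗ ⋯ ⊗ |b⟩`, with one tensor factor for each `l : L`. -/
def ketPow (L : Type*) [Fintype L] (b : Qutrit) (x : L → Qutrit) : ℂ :=
  ∏ l, if x l = b then 1 else 0

/-- The standard representation of the green (`Z`-) spider with phases `φ = (α, β)`, output
legs `O` and input legs `I`: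
`|0⟩^O ⟨0|^I + exp(iα) |1⟩^O ⟨1|^I + exp(iβ) |2⟩^O ⟨2|^I`. -/
def zSpider (O I : Type*) [Fintype O] [Fintype I] (φ : Phase) :
    Matrix (O → Qutrit) (I → Qutrit) ℂ :=
  Matrix.of fun y x => ∑ b : Qutrit, phaseCoeff φ b * (ketPow O b y * ketPow I b x)

/-- The `X`-basis: for `k = 0, 1, 2` this is `|+⟩`, `|ω⟩`, `|ω̄⟩`, with components
`ω ^ (k * j) / √3` in the `Z`-basis. -/
def xKet (k : Qutrit) : Qutrit → ℂ := fun j => omega ^ (k * j).val / (Real.sqrt 3 : ℂ)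

/-- The Hadamard gate `|+⟩⟨0| + |ω⟩⟨1| + |ω̄⟩⟨2|`. -/
def hadamard : Matrix Qutrit Qutrit ℂ := Matrix.of fun j k => xKet k j

/-- The map carried by an edge of non-zero weight `w`: the Hadamard gate on an `H`-edge
(weight `1`), its adjoint on an `H†`-edge (weight `2`). -/
def hBox (w : ZMod 3) : Matrix Qutrit Qutrit ℂ := if w = 2 then hadamardᴴ else hadamard

/-- Either end of an `H`- or `H†`-edge may be taken as its input. -/
theorem hBox_symm (w : ZMod 3) (j k : Qutrit) : hBox w j k = hBox w k j := by
  unfold hBox hadamard xKet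
  split_ifs <;> simp [Matrix.conjTranspose_apply, mul_comm]

/-- Graphs without loops whose edges carry weights in `ℤ/3`, given by their adjacency matrix:
weight `0` means no edge, weight `1` an `H`-edge, weight `2` an `H†`-edge. -/
@[ext]
structure WGraph (V : Type*) where
  weight : V → V → ZMod 3
  symm : ∀ u v, weight u v = weight v u
  loopless : ∀ v, weight v v = 0

namespace WGraph

variable {V : Type*}

/-- The `a`-local complementation at `x`: `w'(u, v) = w(u, v) + a w(u, x) w(v, x)` for all
pairs of distinct nodes `u, v`. -/
def localComp [DecidableEq V] (G : WGraph V) (a : ZMod 3) (x : V) : WGraph V where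
  weight u v := if u = v then 0 else G.weight u v + a * G.weight u x * G.weight v x
  symm u v := by
    by_cases h : u = v
    · simp [h]
    · rw [if_neg h, if_neg (Ne.symm h), G.symm u v]
      ring
  loopless v := by simp

/-- The `(a, b, c)`-pivot along `ij`. -/
def pivot [DecidableEq V] (G : WGraph V) (a b c : ZMod 3) (i j : V) : WGraph V :=
  ((G.localComp a i).localComp b j).localComp c i

/-- The proper `a`-pivot along `ij`, i.e. the `(a, -a, a)`-pivot. -/
def properPivot [DecidableEq V] (G : WGraph V) (a : ZMod 3) (i j : V) : WGraph V :=
  G.pivot a (-a) a i j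

/-- The subgraph on the nodes that satisfy `P`. -/
def induce (G : WGraph V) (P : V → Prop) : WGraph {v // P v} where
  weight u v := G.weight u v
  symm u v := G.symm u v
  loopless v := G.loopless v

/-- The ends of the edges of `G`: the pair `(v, u)` is the end at `v` of an edge `uv`. -/
abbrev HalfEdge (G : WGraph V) : Type _ := {e : V × V // G.weight e.1 e.2 ≠ 0}

end WGraph

/-- A graph-like qutrit ZX-diagram with spiders `V` (all green), `p` input wires and `q` output
wires. Two spiders are joined by at most one `H`- or `H†`-edge, every input or output wire is
attached to a spider, and a spider is attached to at most one of them. -/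
@[ext]
structure GraphLike (V : Type*) (p q : ℕ) where
  graph : WGraph V
  phase : V → Phase
  inp : Fin p → V
  out : Fin q → V
  boundary_injective : Function.Injective (Sum.elim inp out)

namespace GraphLike

variable {V : Type*} {p q : ℕ}

/-- A spider is interior if no input or output wire is attached to it. -/
def Interior (D : GraphLike V p q) (v : V) : Prop :=
  (∀ s, D.inp s ≠ v) ∧ ∀ t, D.out t ≠ v

/-- The internal legs of the spider `v`: one for each of its neighbours. -/
abbrev Nbr (D : GraphLike V p q) (v : V) : Type _ := {u // D.graph.weight v u ≠ 0}

/-- The contribution of the spider `v`, when `z` gives the indices on the edge ends, `x` those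
on the input wires and `y` those on the output wires. The output legs of `v` are its internal
legs and the output wire attached to it, if any; its input legs are the input wire attached to
it, if any. -/
def spiderTensor [Fintype V] [DecidableEq V] (D : GraphLike V p q)
    (y : Fin q → Qutrit) (x : Fin p → Qutrit) (z : D.graph.HalfEdge → Qutrit) (v : V) : ℂ :=
  zSpider (D.Nbr v ⊕ {t // D.out t = v}) {s // D.inp s = v} (D.phase v)
    (Sum.elim (fun u => z ⟨(v, u.1), u.2⟩) fun t => y t.1) (fun s => x s.1)

/-- The contribution of the (possibly absent) edge between `u` and `v`, when `z` gives the
indices on the edge ends. -/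
def edgeEntry (D : GraphLike V p q) (z : D.graph.HalfEdge → Qutrit) (u v : V) : ℂ :=
  if h : D.graph.weight u v ≠ 0 then
    hBox (D.graph.weight u v) (z ⟨(u, v), h⟩) (z ⟨(v, u), by rwa [D.graph.symm] at h⟩)
  else 1

theorem edgeEntry_symm (D : GraphLike V p q) (z : D.graph.HalfEdge → Qutrit) (u v : V) :
    D.edgeEntry z u v = D.edgeEntry z v u := by
  unfold edgeEntry
  by_cases h : D.graph.weight u v ≠ 0
  · have h2 : D.graph.weight v u ≠ 0 := by rwa [D.graph.symm] at h
    rw [dif_pos h, dif_pos h2, hBox_symm, D.graph.symm u v]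
  · have h2 : ¬ D.graph.weight v u ≠ 0 := by rwa [D.graph.symm] at h
    rw [dif_neg h, dif_neg h2]

/-- The contribution of the (possibly absent) edge joining an unordered pair of spiders. -/
def edgeTensor (D : GraphLike V p q) (z : D.graph.HalfEdge → Qutrit) (e : Sym2 V) : ℂ :=
  Sym2.lift ⟨D.edgeEntry z, D.edgeEntry_symm z⟩ e

/-- The standard interpretation of a graph-like diagram as a linear map from `p` to `q` qutrits:
the contraction of the tensors of its spiders and of the gates on its edges, that is, the sum
of their product over all indices on the internal legs. -/
def interp [Fintype V] [DecidableEq V] (D : GraphLike V p q) :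
    Matrix (Fin q → Qutrit) (Fin p → Qutrit) ℂ :=
  Matrix.of fun y x => ∑ z : D.graph.HalfEdge → Qutrit,
    (∏ v, D.spiderTensor y x z v) * ∏ e : Sym2 V, D.edgeTensor z e

/-- The phases that are added to the spider `k` when adjacent interior spiders `i, j` with phases
`mPhase mi`, `mPhase mj`, joined by an edge of weight `w`, are eliminated: the first summand
is trivial unless `k` is a neighbour of `i` or `j`; the second is `(-w, -w)` if `k` is joined
to both by edges of the same weight, `(w, w)` if it is joined to both by edges of different
weights, and trivial otherwise. -/
def phaseUpdate (G : WGraph V) (i j : V) (mi mj : ZMod 3) (k : V) : Phase :=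
  mPhase (-(G.weight i j) * (mi * G.weight k j + mj * G.weight k i)) +
    intPhase (-(G.weight i j) * G.weight k i * G.weight k j)
      (-(G.weight i j) * G.weight k i * G.weight k j)

/-- The diagram obtained by a proper `a`-pivot along `ij`, followed by the removal of the interior
spiders `i` and `j` with all edges at them and by the phase updates on the other spiders. -/
def eliminate [DecidableEq V] (D : GraphLike V p q) (a : ZMod 3) (i j : V) (mi mj : ZMod 3)
    (hi : D.Interior i) (hj : D.Interior j) : GraphLike {k // k ≠ i ∧ k ≠ j} p q where
  graph := (D.graph.properPivot a i j).induce fun k => k ≠ i ∧ k ≠ j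
  phase k := D.phase k.1 + phaseUpdate D.graph i j mi mj k.1
  inp s := ⟨D.inp s, hi.1 s, hj.1 s⟩
  out t := ⟨D.out t, hi.2 t, hj.2 t⟩
  boundary_injective := by
    intro s t h
    apply D.boundary_injective
    rcases s with s | s <;> rcases t with t | t <;>
      simpa using congrArg Subtype.val h

end GraphLike

end QutritZX

end

open scoped Matrix

noncomputable section

namespace QutritZX

/-! Spiders force equal labels on all their legs, so (`interp_apply`) a diagram is a nonzero scalar
times a sum over labellings `b : V → ℤ/3` of boundary and phase factors times `ω` to the power `∑
w(u,v) b(u) b(v)` over edges. Let `s, t` be the labels of `i, j` and `A, B` the linear forms by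
which the other labels couple to them. The part of the exponent with `s, t` is `w s t + (mi + A) s +
(mj + B) t`, and `sum_sum_chi` sums it out to `3 ω ^ (-w (mi + A) (mj + B))`. In the expansion, `-w
mi mj` goes into the scalar and the linear terms are the `mPhase` updates. The off-diagonal part of
`-w A B` is the pivot's change of weights (`properPivot_weight`), its diagonal part the quadratic
phases (`form_eliminate`). -/

/-- The additive character `n ↦ ω ^ n` of `ℤ/3`. -/
def chi (n : ZMod 3) : ℂ := omega ^ n.val

/-! ### Character sums over `ℤ/3`. -/

theorem omega_eq : omega = Complex.exp (2 * Real.pi * Complex.I / (3 : ℕ)) := by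
  simp [omega]

theorem omega_isPrimitiveRoot : IsPrimitiveRoot omega 3 := by
  rw [omega_eq]
  exact Complex.isPrimitiveRoot_exp 3 (by norm_num)

theorem omega_pow_three : omega ^ 3 = 1 := omega_isPrimitiveRoot.pow_eq_one

theorem chi_zero : chi 0 = 1 := by simp [chi]

theorem chi_add (m n : ZMod 3) : chi (m + n) = chi m * chi n := by
  simp only [chi, ZMod.val_add, ← pow_add]
  exact (pow_eq_pow_mod _ omega_pow_three).symm

theorem chi_ne_zero (n : ZMod 3) : chi n ≠ 0 :=
  pow_ne_zero _ (omega_isPrimitiveRoot.ne_zero (by norm_num))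

theorem chi_sum {ι : Type*} (s : Finset ι) (f : ι → ZMod 3) :
    chi (∑ k ∈ s, f k) = ∏ k ∈ s, chi (f k) := by
  classical
  induction s using Finset.induction_on with
  | empty => simp [chi_zero]
  | insert a s ha ih => rw [Finset.sum_insert ha, Finset.prod_insert ha, chi_add, ih]

theorem sum_zmod_three {M : Type*} [AddCommMonoid M] (f : ZMod 3 → M) :
    ∑ s, f s = f 0 + f 1 + f 2 := Fin.sum_univ_three f

theorem one_add_omega_add_sq : 1 + omega + omega ^ 2 = 0 := by
  have h := omega_isPrimitiveRoot.geom_sum_eq_zero (by norm_num)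
  simpa [Finset.sum_range_succ] using h

theorem sum_chi_mul (n : ZMod 3) : ∑ s, chi (s * n) = if n = 0 then 3 else 0 := by
  have h0 : ∀ s : ZMod 3, s = 0 ∨ s = 1 ∨ s = 2 := by decide
  have v1 : (1 : ZMod 3).val = 1 := rfl
  have v2 : (2 : ZMod 3).val = 2 := rfl
  have h4 : (2 * 2 : ZMod 3) = 1 := by decide
  have h := one_add_omega_add_sq
  rw [sum_zmod_three]
  rcases h0 n with rfl | rfl | rfl
  · norm_num [chi]
  · rw [if_neg (by decide)]
    simpa [chi, v1, v2] using h
  · rw [if_neg (by decide), h4]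
    simp only [chi, v1, v2, zero_mul, one_mul, ZMod.val_zero]
    linear_combination h

/-- Eliminating two labels coupled by `w s t`. -/
theorem sum_sum_chi {w : ZMod 3} (hw : w ≠ 0) (A B : ZMod 3) :
    ∑ s, ∑ t, chi (w * s * t + A * s + B * t) = 3 * chi (-w * A * B) := by
  have hsq : w * w = 1 := by revert w; decide
  rw [Finset.sum_comm]
  -- By orthogonality only `w t + A = 0` survives; `w` is its own inverse, so `t = -w A`.
  have h : ∀ t : ZMod 3, ∑ s, chi (w * s * t + A * s + B * t) =
      if t = -w * A then 3 * chi (-w * A * B) else 0 := by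
    intro t
    have h1 : ∀ s, chi (w * s * t + A * s + B * t) = chi (s * (w * t + A)) * chi (B * t) := by
      intro s
      rw [← chi_add]
      congr 1
      ring
    simp_rw [h1]
    rw [← Finset.sum_mul, sum_chi_mul]
    have h2 : w * t + A = 0 ↔ t = -w * A := by
      constructor
      · intro h
        linear_combination w * h - t * hsq
      · rintro rfl
        linear_combination -A * hsq
    simp only [h2, ite_mul, zero_mul]
    split_ifs with h3
    · rw [h3]
      congr 2
      ring
    · rfl
  simp_rw [h]
  simp

/-! ### Gates and phases as characters. -/

theorem hBox_eq {w : ZMod 3} (hw : w ≠ 0) (j k : Qutrit) :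
    hBox w j k = (Real.sqrt 3 : ℂ)⁻¹ * chi (w * j * k) := by
  have h0 : ∀ s : ZMod 3, s ≠ 0 → s = 1 ∨ s = 2 := by decide
  have hconj : ∀ n : ZMod 3, (starRingEnd ℂ) (omega ^ n.val) = chi (2 * n) := by
    intro n
    have h1 : omega * (starRingEnd ℂ) omega = 1 := by
      rw [Complex.mul_conj, Complex.normSq_eq_norm_sq,
        omega_isPrimitiveRoot.norm'_eq_one (by norm_num)]
      norm_num
    have h2 : chi (2 * n) * omega ^ n.val = 1 := by
      change chi (2 * n) * chi n = 1
      rw [← chi_add, ← chi_zero]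
      congr 1
      revert n; decide
    have h3 : omega ^ n.val * (starRingEnd ℂ) (omega ^ n.val) = 1 := by
      rw [map_pow, ← mul_pow, h1, one_pow]
    calc _ = (chi (2 * n) * omega ^ n.val) * (starRingEnd ℂ) (omega ^ n.val) := by
            rw [h2, one_mul]
      _ = _ := by rw [mul_assoc, h3, mul_one]
  rcases h0 w hw with rfl | rfl
  · rw [hBox, if_neg (by decide)]
    simp [hadamard, xKet, chi, div_eq_inv_mul, mul_comm]
  · rw [hBox, if_pos rfl]
    simp only [hadamard, xKet, Matrix.conjTranspose_apply, Matrix.of_apply, star_div₀]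
    rw [show star (omega ^ (j * k).val) = (starRingEnd ℂ) (omega ^ (j * k).val) from rfl, hconj,
      show star (Real.sqrt 3 : ℂ) = Real.sqrt 3 from Complex.conj_ofReal _, div_eq_inv_mul,
      mul_assoc 2 j k]

theorem toCircle_thirdTurn (n : ZMod 3) : ((thirdTurn n).toCircle : ℂ) = chi n := by
  rw [thirdTurn, Real.Angle.toCircle_coe, Circle.coe_exp, chi, omega, ← Complex.exp_nat_mul]
  congr 1
  push_cast
  ring

theorem phaseCoeff_add (φ ψ : Phase) (b : Qutrit) :
    phaseCoeff (φ + ψ) b = phaseCoeff φ b * phaseCoeff ψ b := by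
  unfold phaseCoeff
  split_ifs <;> simp [Real.Angle.toCircle_add]

/-- Both nonzero labels have square `1`, so equal decorations encode a quadratic exponent. -/
theorem phaseCoeff_intPhase_self (n : ZMod 3) (b : Qutrit) :
    phaseCoeff (intPhase n n) b = chi (n * b * b) := by
  have h0 : ∀ s : ZMod 3, s = 0 ∨ s = 1 ∨ s = 2 := by decide
  have h4 : n * 2 * 2 = n := by revert n; decide
  rcases h0 b with rfl | rfl | rfl
  · simp [phaseCoeff, chi_zero]
  · simp [phaseCoeff, intPhase, toCircle_thirdTurn]
  · rw [h4, phaseCoeff, if_neg (by decide), if_neg (by decide)]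
    exact toCircle_thirdTurn n

theorem phaseCoeff_mPhase (n : ZMod 3) (b : Qutrit) :
    phaseCoeff (mPhase n) b = chi (n * b) := by
  have h0 : ∀ s : ZMod 3, s = 0 ∨ s = 1 ∨ s = 2 := by decide
  have h4 : n * 2 = -n := by revert n; decide
  rcases h0 b with rfl | rfl | rfl
  · simp [phaseCoeff, chi_zero]
  · simp [phaseCoeff, mPhase, intPhase, toCircle_thirdTurn]
  · rw [h4, phaseCoeff, if_neg (by decide), if_neg (by decide)]
    exact toCircle_thirdTurn (-n)

/-- In characteristic three, the sum of a symmetric function that vanishes on the diagonal over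
unordered pairs is minus its sum over ordered pairs. -/
theorem sum_sym2_lift {V : Type*} [Fintype V] [DecidableEq V] (f : V → V → ZMod 3)
    (hf : ∀ u v, f u v = f v u) (h0 : ∀ v, f v v = 0) :
    ∑ e : Sym2 V, Sym2.lift ⟨f, hf⟩ e = -∑ u, ∑ v, f u v := by
  -- Off the diagonal each unordered pair has two orderings; diagonal pairs have one but contribute
  -- zero. Then `2 = -1`.
  have h : ∑ u, ∑ v, f u v = 2 * ∑ e : Sym2 V, Sym2.lift ⟨f, hf⟩ e := by
    rw [← Fintype.sum_prod_type', ← Finset.sum_fiberwise Finset.univ (fun p : V × V => s(p.1, p.2)),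
      Finset.mul_sum]
    refine Finset.sum_congr rfl fun e _ => ?_
    induction e using Sym2.ind with
    | _ u v =>
      by_cases huv : u = v
      · subst huv
        have : (Finset.univ.filter fun p : V × V => s(p.1, p.2) = s(u, u)) = {(u, u)} := by
          ext ⟨a, b⟩
          simp
        rw [this]
        simp [h0]
      · have : (Finset.univ.filter fun p : V × V => s(p.1, p.2) = s(u, v)) =
            {(u, v), (v, u)} := by
          ext ⟨a, b⟩
          simp
        rw [this, Finset.sum_pair (by simp [huv])]
        simp only [Sym2.lift_mk]
        rw [hf v u]
        ring
  rw [h]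
  generalize ∑ e : Sym2 V, Sym2.lift ⟨f, hf⟩ e = x
  revert x; decide

/-! ### Weighted graphs and the proper pivot. -/

namespace WGraph

variable {V : Type*}

/-- The product of the scalars `1 / √3` of the Hadamard gates on the edges of a graph. -/
def edgeScalar [Fintype V] [DecidableEq V] (G : WGraph V) : ℂ :=
  ∏ e : Sym2 V, if Sym2.lift ⟨G.weight, G.symm⟩ e = 0 then 1 else (Real.sqrt 3 : ℂ)⁻¹

theorem edgeScalar_ne_zero [Fintype V] [DecidableEq V] (G : WGraph V) : G.edgeScalar ≠ 0 := by
  refine Finset.prod_ne_zero_iff.2 fun e _ => ?_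
  split_ifs
  · exact one_ne_zero
  · simp

/-- The quadratic form `∑ w(u, v) b(u) b(v)`, summed over ordered pairs. -/
def form [Fintype V] (G : WGraph V) (b : V → ZMod 3) : ZMod 3 :=
  ∑ u, ∑ v, G.weight u v * b u * b v

/-- Expanding the three complementations and using `a² = w² = 1`, the terms odd in `a` cancel and
the remaining ones contain only `a²`. Hence the choice of `a` is immaterial. -/
theorem properPivot_weight [DecidableEq V] (G : WGraph V) {a : ZMod 3} (ha : a ≠ 0) {i j : V}
    (hij : G.weight i j ≠ 0) {k l : V} (hki : k ≠ i) (hkj : k ≠ j) (hli : l ≠ i) (hlj : l ≠ j) :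
    (G.properPivot a i j).weight k l = if k = l then 0 else G.weight k l -
      G.weight i j * (G.weight k i * G.weight l j + G.weight k j * G.weight l i) := by
  have hne : i ≠ j := fun h => hij (by rw [h, G.loopless])
  have ha2 : a * a = 1 := by revert a; decide
  have hw : G.weight i j * G.weight i j = 1 := by
    revert hij
    generalize G.weight i j = w
    revert w; decide
  simp only [properPivot, pivot, localComp, if_neg hki, if_neg hkj, if_neg hli, if_neg hlj,
    if_neg hne, G.loopless, G.symm j i]
  split_ifs
  · rfl
  · generalize G.weight i j = w at *
    generalize G.weight k i = x
    generalize G.weight k j = y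
    generalize G.weight l i = x'
    generalize G.weight l j = y'
    generalize G.weight k l = z
    have hd : a * a * (w * w) = 1 := by rw [ha2, hw, one_mul]
    linear_combination (-a * x * x' + a * y * y' + a * (a * a * (w * w) - 1) * x * x' +
      a * a * w * (x * y' + x' * y)) * hd - w * (x * y' + x' * y) * ha2

theorem induce_properPivot_eq [DecidableEq V] (G : WGraph V) {a a' : ZMod 3} (ha : a ≠ 0)
    (ha' : a' ≠ 0) {i j : V} (hij : G.weight i j ≠ 0) :
    (G.properPivot a i j).induce (fun k => k ≠ i ∧ k ≠ j) =
      (G.properPivot a' i j).induce fun k => k ≠ i ∧ k ≠ j := by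
  ext ⟨k, hk⟩ ⟨l, hl⟩
  simp only [induce]
  rw [G.properPivot_weight ha hij hk.1 hk.2 hl.1 hl.2,
    G.properPivot_weight ha' hij hk.1 hk.2 hl.1 hl.2]

end WGraph

/-! ### Splitting off the nodes `i` and `j`. -/

theorem sum_eq_add_add_rest {V M : Type*} [Fintype V] [DecidableEq V] [AddCommMonoid M] {i j : V}
    (hij : i ≠ j) (f : V → M) :
    ∑ v, f v = f i + f j + ∑ k : {k // k ≠ i ∧ k ≠ j}, f k := by
  rw [← Finset.sum_filter_add_sum_filter_not Finset.univ (fun v => v = i ∨ v = j)]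
  congr 1
  · rw [show (Finset.univ.filter fun v => v = i ∨ v = j) = {i, j} by ext; simp,
      Finset.sum_pair hij]
  · exact Finset.sum_subtype _ (by simp) f

theorem prod_eq_mul_mul_rest {V M : Type*} [Fintype V] [DecidableEq V] [CommMonoid M] {i j : V}
    (hij : i ≠ j) (f : V → M) :
    ∏ v, f v = f i * f j * ∏ k : {k // k ≠ i ∧ k ≠ j}, f k :=
  sum_eq_add_add_rest (M := Additive M) hij f

/-- A function on the nodes is given by its values at `i` and `j` and its restriction to the other
nodes. -/
def splitPair {V : Type*} [DecidableEq V] {i j : V} (hij : i ≠ j) (X : Type*) :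
    ({k // k ≠ i ∧ k ≠ j} → X) × X × X ≃ (V → X) where
  toFun p k := if hi : k = i then p.2.1 else if hj : k = j then p.2.2 else p.1 ⟨k, hi, hj⟩
  invFun b := (fun k => b k, b i, b j)
  left_inv := by
    rintro ⟨b, s, t⟩
    refine Prod.ext (funext fun k => ?_) (Prod.ext ?_ ?_)
    · simp [k.2.1, k.2.2]
    · simp
    · simp [hij.symm]
  right_inv b := by
    funext k
    dsimp only
    split_ifs with h1 h2
    · rw [h1]
    · rw [h2]
    · rfl

section

variable {V X : Type*} [DecidableEq V] {i j : V} (hij : i ≠ j)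
  (b : {k // k ≠ i ∧ k ≠ j} → X) (s t : X)

theorem splitPair_left : splitPair hij X (b, s, t) i = s := by simp [splitPair]

theorem splitPair_right : splitPair hij X (b, s, t) j = t := by simp [splitPair, hij.symm]

theorem splitPair_rest (k : V) (hk : k ≠ i ∧ k ≠ j) :
    splitPair hij X (b, s, t) k = b ⟨k, hk⟩ := by
  simp [splitPair, hk.1, hk.2]

end

theorem form_splitPair {V : Type*} [Fintype V] [DecidableEq V] (G : WGraph V) {i j : V}
    (hij : i ≠ j) (b : {k // k ≠ i ∧ k ≠ j} → ZMod 3) (s t : ZMod 3) :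
    G.form (splitPair hij (ZMod 3) (b, s, t)) = (G.induce fun k => k ≠ i ∧ k ≠ j).form b +
      2 * (G.weight i j * s * t + (∑ k, G.weight k.1 i * b k) * s +
        (∑ k, G.weight k.1 j * b k) * t) := by
  unfold WGraph.form
  simp only [sum_eq_add_add_rest hij, splitPair_left, splitPair_right,
    fun k : {k // k ≠ i ∧ k ≠ j} => splitPair_rest hij b s t k.1 k.2, Subtype.coe_eta,
    G.loopless, Finset.sum_add_distrib, G.symm j i, WGraph.induce]
  have h : ∀ (l : V) (r : ZMod 3),
      (∑ k : {k // k ≠ i ∧ k ≠ j}, G.weight l k.1 * r * b k =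
        (∑ k : {k // k ≠ i ∧ k ≠ j}, G.weight k.1 l * b k) * r) ∧
      ∑ k : {k // k ≠ i ∧ k ≠ j}, G.weight k.1 l * b k * r =
        (∑ k : {k // k ≠ i ∧ k ≠ j}, G.weight k.1 l * b k) * r := by
    intro l r
    rw [Finset.sum_mul]
    refine ⟨Finset.sum_congr rfl fun k _ => ?_, rfl⟩
    rw [G.symm l]
    ring
  rw [(h i s).1, (h j t).1, (h i s).2, (h j t).2]
  ring

/-- The pivot subtracts the product of the two linear forms, but graphs have no loops, so the
diagonal terms of that product must be put back. -/
theorem form_eliminate {V : Type*} [Fintype V] [DecidableEq V] (G : WGraph V) {a : ZMod 3}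
    (ha : a ≠ 0) {i j : V} (hij : G.weight i j ≠ 0) (b : {k // k ≠ i ∧ k ≠ j} → ZMod 3) :
    ((G.properPivot a i j).induce fun k => k ≠ i ∧ k ≠ j).form b =
      (G.induce fun k => k ≠ i ∧ k ≠ j).form b +
      2 * G.weight i j * (∑ k, G.weight k.1 i * G.weight k.1 j * b k * b k -
        (∑ k, G.weight k.1 i * b k) * ∑ k, G.weight k.1 j * b k) := by
  unfold WGraph.form
  have h : ∀ k l : {k // k ≠ i ∧ k ≠ j},
      ((G.properPivot a i j).induce fun k => k ≠ i ∧ k ≠ j).weight k l * b k * b l =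
      (G.induce fun k => k ≠ i ∧ k ≠ j).weight k l * b k * b l +
      ((if k = l then 2 * G.weight i j * (G.weight k.1 i * G.weight k.1 j * b k * b k) else 0) -
        G.weight i j * ((G.weight k.1 i * b k) * (G.weight l.1 j * b l)) -
        G.weight i j * ((G.weight k.1 j * b k) * (G.weight l.1 i * b l))) := by
    rintro ⟨k, hk⟩ ⟨l, hl⟩
    simp only [WGraph.induce]
    rw [G.properPivot_weight ha hij hk.1 hk.2 hl.1 hl.2]
    by_cases hkl : k = l
    · subst hkl
      simp only [if_true, G.loopless]
      ring
    · simp only [Subtype.mk.injEq, if_neg hkl]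
      ring
  simp_rw [h, Finset.sum_add_distrib, Finset.sum_sub_distrib, ← Finset.mul_sum,
    ← Finset.sum_mul]
  simp only [Finset.sum_ite_eq, Finset.mem_univ, if_true, ← Finset.mul_sum]
  ring

/-! ### Contraction of diagrams and elimination of two spiders. -/

namespace GraphLike

variable {V : Type*} {p q : ℕ}

/-- The condition that a labelling of the spiders agrees with the indices on the input and output
wires, as a factor `0` or `1`. -/
def boundaryFactor (D : GraphLike V p q) (y : Fin q → Qutrit) (x : Fin p → Qutrit)
    (b : V → Qutrit) : ℂ :=
  (∏ t, if y t = b (D.out t) then 1 else 0) * ∏ s, if x s = b (D.inp s) then 1 else 0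

theorem prod_ketPow_fiber {ι : Type*} [Fintype ι] [Fintype V] [DecidableEq V] (f : ι → V)
    (y : ι → Qutrit) (b : V → Qutrit) :
    ∏ v, ketPow {t // f t = v} (b v) (fun t => y t.1) = ∏ t, if y t = b (f t) then 1 else 0 := by
  rw [← Fintype.prod_fiberwise f]
  refine Finset.prod_congr rfl fun v _ => Finset.prod_congr rfl fun t _ => ?_
  rw [t.2]

/-- `form` counts each edge twice, and `1/2 = -1` modulo 3; hence the sign. -/
theorem prod_edgeTensor [Fintype V] [DecidableEq V] (D : GraphLike V p q) (b : V → Qutrit) :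
    ∏ e : Sym2 V, D.edgeTensor (fun e => b e.1.1) e =
      D.graph.edgeScalar * chi (-D.graph.form b) := by
  have hs : ∀ u v, D.graph.weight u v * b u * b v = D.graph.weight v u * b v * b u := by
    intro u v
    rw [D.graph.symm u v]
    ring
  have h := sum_sym2_lift (fun u v => D.graph.weight u v * b u * b v) hs
    (fun v => by simp [D.graph.loopless])
  rw [WGraph.form, ← h, chi_sum, WGraph.edgeScalar, ← Finset.prod_mul_distrib]
  refine Finset.prod_congr rfl fun e _ => ?_
  induction e using Sym2.ind with
  | _ u v =>
    simp only [edgeTensor, Sym2.lift_mk, edgeEntry]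
    by_cases huv : D.graph.weight u v = 0
    · simp [huv, chi_zero]
    · rw [dif_pos huv]
      exact (hBox_eq huv _ _).trans (by simp [huv])

theorem ketPow_sum {L M : Type*} [Fintype L] [Fintype M] (b : Qutrit) (f : L → Qutrit)
    (g : M → Qutrit) : ketPow (L ⊕ M) b (Sum.elim f g) = ketPow L b f * ketPow M b g := by
  exact Fintype.prod_sum_type _

/-- The contraction of a diagram as a sum over labellings of its spiders. -/
theorem interp_apply [Fintype V] [DecidableEq V] (D : GraphLike V p q) (y : Fin q → Qutrit)
    (x : Fin p → Qutrit) :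
    D.interp y x = D.graph.edgeScalar * ∑ b : V → Qutrit, D.boundaryFactor y x b *
      (∏ v, phaseCoeff (D.phase v) (b v)) * chi (-D.graph.form b) := by
  -- Edge-end indices that disagree with the labelling at some spider kill a factor there, so only
  -- one `z` survives for each `b`.
  have hz : ∀ (b : V → Qutrit) (z : D.graph.HalfEdge → Qutrit),
      z ≠ (fun e => b e.1.1) → ∏ v, ketPow (D.Nbr v) (b v) (fun u => z ⟨(v, u.1), u.2⟩) = 0 := by
    intro b z hne
    obtain ⟨⟨⟨v, u⟩, h⟩, he⟩ := Function.ne_iff.1 hne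
    exact Finset.prod_eq_zero (Finset.mem_univ v)
      (Finset.prod_eq_zero (Finset.mem_univ (⟨u, h⟩ : D.Nbr v)) (if_neg he))
  simp only [interp, spiderTensor, zSpider, Matrix.of_apply, ketPow_sum]
  simp_rw [Finset.prod_univ_sum, Fintype.piFinset_univ, Finset.prod_mul_distrib, Finset.sum_mul]
  rw [Finset.sum_comm, Finset.mul_sum]
  refine Finset.sum_congr rfl fun b _ => ?_
  rw [Finset.sum_eq_single (fun e : D.graph.HalfEdge => b e.1.1)]
  · rw [prod_edgeTensor, prod_ketPow_fiber, prod_ketPow_fiber, boundaryFactor]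
    simp only [ketPow, if_true, Finset.prod_const_one]
    ring
  · intro z _ hne
    rw [hz b z hne]
    simp
  · simp

/-- Summing out the labels of `i` and `j` gives the diagram with these spiders eliminated. -/
theorem interp_eq_smul_eliminate [Fintype V] [DecidableEq V] (D : GraphLike V p q) {i j : V}
    (hij : D.graph.weight i j ≠ 0) {mi mj : ZMod 3} (hi : D.Interior i) (hj : D.Interior j)
    (hmi : D.phase i = mPhase mi) (hmj : D.phase j = mPhase mj) {a : ZMod 3} (ha : a ≠ 0) :
    D.interp = (D.graph.edgeScalar * (3 * chi (-(D.graph.weight i j) * mi * mj)) *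
      ((D.graph.properPivot a i j).induce fun k => k ≠ i ∧ k ≠ j).edgeScalar⁻¹) •
        (D.eliminate a i j mi mj hi hj).interp := by
  have hne : i ≠ j := fun h => hij (by rw [h, D.graph.loopless])
  ext y x
  rw [Matrix.smul_apply, smul_eq_mul, interp_apply, interp_apply]
  have hS := ((D.graph.properPivot a i j).induce fun k => k ≠ i ∧ k ≠ j).edgeScalar_ne_zero
  change _ = _ * (((D.graph.properPivot a i j).induce fun k => k ≠ i ∧ k ≠ j).edgeScalar * _)
  generalize ((D.graph.properPivot a i j).induce fun k => k ≠ i ∧ k ≠ j).edgeScalar = S at hS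
  rw [mul_assoc, inv_mul_cancel_left₀ hS, mul_assoc]
  congr 1
  rw [← (splitPair hne Qutrit).sum_comp, Fintype.sum_prod_type, Finset.mul_sum]
  refine Finset.sum_congr rfl fun b _ => ?_
  -- No wire meets `i` or `j`, as both are interior.
  have hbd : ∀ s t, D.boundaryFactor y x (splitPair hne Qutrit (b, s, t)) =
      (D.eliminate a i j mi mj hi hj).boundaryFactor y x b := by
    intro s t
    simp only [boundaryFactor, eliminate]
    congr 1 <;> refine Finset.prod_congr rfl fun r _ => ?_
    · exact if_congr (by rw [splitPair_rest hne b s t _ ⟨hi.2 r, hj.2 r⟩]) rfl rfl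
    · exact if_congr (by rw [splitPair_rest hne b s t _ ⟨hi.1 r, hj.1 r⟩]) rfl rfl
  rw [Fintype.sum_prod_type]
  simp_rw [hbd, prod_eq_mul_mul_rest hne, splitPair_left, splitPair_right,
    fun s t (k : {k // k ≠ i ∧ k ≠ j}) => splitPair_rest hne b s t k.1 k.2, hmi, hmj,
    phaseCoeff_mPhase, form_splitPair]
  set A := ∑ k : {k // k ≠ i ∧ k ≠ j}, D.graph.weight k.1 i * b k with hA
  set B := ∑ k : {k // k ≠ i ∧ k ≠ j}, D.graph.weight k.1 j * b k with hB
  set F := (D.graph.induce fun k => k ≠ i ∧ k ≠ j).form b with hF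
  set w := D.graph.weight i j with hw
  set C := ∑ k : {k // k ≠ i ∧ k ≠ j}, D.graph.weight k.1 i * D.graph.weight k.1 j * b k * b k
    with hC
  have hphase : ∏ k, phaseCoeff ((D.eliminate a i j mi mj hi hj).phase k) (b k) =
      (∏ k : {k // k ≠ i ∧ k ≠ j}, phaseCoeff (D.phase k.1) (b k)) *
        chi (-w * (mi * B + mj * A) - w * C) := by
    have : -w * (mi * B + mj * A) - w * C = ∑ k : {k // k ≠ i ∧ k ≠ j},
        (-w * (mi * D.graph.weight k.1 j + mj * D.graph.weight k.1 i) * b k +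
          -w * D.graph.weight k.1 i * D.graph.weight k.1 j * b k * b k) := by
      simp only [hA, hB, hC, Finset.mul_sum, ← Finset.sum_add_distrib, ← Finset.sum_sub_distrib]
      exact Finset.sum_congr rfl fun k _ => by ring
    rw [this, chi_sum, ← Finset.prod_mul_distrib]
    refine Finset.prod_congr rfl fun k _ => ?_
    simp only [eliminate, phaseUpdate]
    rw [phaseCoeff_add, phaseCoeff_add, phaseCoeff_mPhase, phaseCoeff_intPhase_self, chi_add]
  rw [hphase]
  have hform : (D.eliminate a i j mi mj hi hj).graph.form b = F + 2 * w * (C - A * B) :=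
    form_eliminate D.graph ha hij b
  rw [hform]
  have h3 : (3 : ZMod 3) = 0 := by decide
  have hterm : ∀ s t : ZMod 3, chi (mi * s) * chi (mj * t) *
      chi (-(F + 2 * (w * s * t + A * s + B * t))) =
      chi (-F) * chi (w * s * t + (mi + A) * s + (mj + B) * t) := by
    intro s t
    simp only [← chi_add]
    congr 1
    linear_combination (-(w * s * t + A * s + B * t)) * h3
  set P := ∏ k : {k // k ≠ i ∧ k ≠ j}, phaseCoeff (D.phase k.1) (b k)
  set β := (D.eliminate a i j mi mj hi hj).boundaryFactor y x b
  calc _ = ∑ s, ∑ t, β * P * chi (-F) * chi (w * s * t + (mi + A) * s + (mj + B) * t) := by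
        refine Finset.sum_congr rfl fun s _ => Finset.sum_congr rfl fun t _ => ?_
        linear_combination β * P * hterm s t
    _ = β * P * chi (-F) * (3 * chi (-w * (mi + A) * (mj + B))) := by
        simp_rw [← Finset.mul_sum]
        rw [sum_sum_chi hij]
    _ = 3 * β * P * (chi (-F) * chi (-w * (mi + A) * (mj + B))) := by ring
    _ = 3 * β * P * (chi (-w * mi * mj) * (chi (-w * (mi * B + mj * A) - w * C) *
          chi (-(F + 2 * w * (C - A * B))))) := by
        simp only [← chi_add]
        congr 2
        -- The diagonal sum `C` enters from the phases as `-w C` and from the form as `-2 w C`,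
        -- cancelling modulo 3; `2 w A B` becomes `-w A B`.
        linear_combination (w * C - w * A * B) * h3
    _ = _ := by ring

theorem eliminate_eq_eliminate [DecidableEq V] (D : GraphLike V p q) {i j : V}
    (hij : D.graph.weight i j ≠ 0) (mi mj : ZMod 3) (hi : D.Interior i) (hj : D.Interior j)
    {a a' : ZMod 3} (ha : a ≠ 0) (ha' : a' ≠ 0) :
    D.eliminate a i j mi mj hi hj = D.eliminate a' i j mi mj hi hj := by
  unfold eliminate
  congr 1
  exact D.graph.induce_properPivot_eq ha ha' hij

end GraphLike

end QutritZX

end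

theorem mainTheorem1 {V : Type*} [Fintype V] [DecidableEq V] (G : QutritZX.WGraph V)
    (i j : V) (hij : G.weight i j ≠ 0) (mi mj : ZMod 3) :
    ∃ c : ℂ, c ≠ 0 ∧
      ∀ (p q : ℕ) (D : QutritZX.GraphLike V p q), D.graph = G →
        ∀ (hi : D.Interior i) (hj : D.Interior j),
          D.phase i = QutritZX.mPhase mi → D.phase j = QutritZX.mPhase mj →
            (∀ a : ZMod 3, a ≠ 0 → D.interp = c • (D.eliminate a i j mi mj hi hj).interp) ∧
            D.eliminate 1 i j mi mj hi hj = D.eliminate 2 i j mi mj hi hj := by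
  -- The scalar must precede `a`, so the pivoted graph is taken at `a = 1`; the other choice gives
  -- the same induced graph.
  refine ⟨G.edgeScalar * (3 * QutritZX.chi (-(G.weight i j) * mi * mj)) *
    ((G.properPivot 1 i j).induce fun k => k ≠ i ∧ k ≠ j).edgeScalar⁻¹, ?_, ?_⟩
  · exact mul_ne_zero (mul_ne_zero G.edgeScalar_ne_zero
      (mul_ne_zero (by norm_num) (QutritZX.chi_ne_zero _)))
      (inv_ne_zero (QutritZX.WGraph.edgeScalar_ne_zero _))
  · rintro p q D rfl hi hj hmi hmj
    refine ⟨fun a ha => ?_, D.eliminate_eq_eliminate hij mi mj hi hj (by decide) (by decide)⟩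
    rw [D.graph.induce_properPivot_eq (by decide) ha hij]
    exact D.interp_eq_smul_eliminate hij hi hj hmi hmj ha
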